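/- **Theorem 5.8.** Let $Q$ be a connected smooth manifold of dimension $n>2$ with a smooth contravariant pseudo-Riemannian metric $\mathbf G=(g^{ij})$ of arbitrary signature. For symmetric contravariant tensors let $[\cdot,\cdot]$ be the Lie–Schouten bracket and $\odot$ the symmetric product. A *conformal Killing tensor* is a smooth symmetric contravariant two-tensor field $\mathbf K$ with $[\mathbf K,\mathbf G]=\mathbf C\odot\mathbf G$ for some vector field $\mathbf C$; a *conformal Killing vector* is a smooth vector field $\mathbf X$ with $\mathcal L_{\mathbf X}\mathbf G=F\,\mathbf G$ for some function $F$. Let $(\mathbf K_1,\dots,\mathbf K_{n-1},\mathbf K_n=\mathbf G)$ be a basis of a conformal Killing space with common eigenvectors $(\mathbf E_1,\dots,\mathbf E_n)$, i.e. (these are the tensors associated with orthogonal conformal separable coordinates): the $\mathbf K_a$ are pointwise linearly independent conformal Killing tensors; they are pairwise in conformal involution, $[\mathbf K_a,\mathbf K_b]=\mathbf C_{ab}\odot\mathbf G$ for some vector fields $\mathbf C_{ab}$; and $\mathbf E_1,\dots,\mathbf E_n$ are smooth vector fields forming a basis of each tangent space, each $\mathbf E_i$ being an eigenvector of every $\mathbf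 K_a$ with respect to $\mathbf G$, with real eigenvalue $\lambda_a^i$. Let $\Lambda=(\lambda_a^b)$ (row index $a$, column index $b$), let $\Lambda_j^i$ be the submatrix of $\Lambda$ obtained by deleting the $j$-th row and the $i$-th column, and put $$f_i^{jh}=(-1)^{j+h}\,\frac{\det\Lambda_j^i}{\det\Lambda_h^i},$$ a function on the set where $\det\Lambda_h^i\neq0$; it is called *undefined* if $\det\Lambda_h^i$ vanishes identically on $Q$. Then, for every $i=1,\dots,n$, there is a nowhere vanishing function $\varphi$ on $Q$ such that $\varphi\,\mathbf E_i$ is a conformal Killing vector if and only if, for all $h<j<n$, the function $f_i^{jh}$ is constant (on the set where it is defined) or undefined. -/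

import Mathlib

open scoped Manifold ContDiff

namespace ConformalSeparation

section

variable {n : ℕ} {M : Type*} [TopologicalSpace M] [ChartedSpace (EuclideanSpace ℝ (Fin n)) M]

/-- The cotangent space at `x` of an `n`-dimensional manifold `M`. -/
abbrev Cotangent (n : ℕ) {M : Type*} [TopologicalSpace M]
    [ChartedSpace (EuclideanSpace ℝ (Fin n)) M] (x : M) : Type :=
  TangentSpace (𝓡 n) x →L[ℝ] ℝ

/-- A (rough) vector field on `M`. -/
abbrev VField (n : ℕ) (M : Type*) [TopologicalSpace M]
    [ChartedSpace (EuclideanSpace ℝ (Fin n)) M] : Type _ :=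
  (x : M) → TangentSpace (𝓡 n) x

/-- A (rough) contravariant two-tensor field on `M`: a bilinear form on every cotangent space. -/
abbrev TwoTensor (n : ℕ) (M : Type*) [TopologicalSpace M]
    [ChartedSpace (EuclideanSpace ℝ (Fin n)) M] : Type _ :=
  (x : M) → LinearMap.BilinForm ℝ (Cotangent n x)

/-- A smooth real function on `M`. -/
def SmoothFun (n : ℕ) {M : Type*} [TopologicalSpace M]
    [ChartedSpace (EuclideanSpace ℝ (Fin n)) M] (u : M → ℝ) : Prop :=
  ContMDiff (𝓡 n) 𝓘(ℝ, ℝ) ∞ u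

/-- The differential `du` of a function, as a field of covectors. -/
noncomputable def differential (n : ℕ) {M : Type*} [TopologicalSpace M]
    [ChartedSpace (EuclideanSpace ℝ (Fin n)) M] (u : M → ℝ) (x : M) : Cotangent n x :=
  mvfderiv (𝓡 n) u x

/-- A smooth vector field (a smooth section of the tangent bundle). -/
def IsSmoothVField [IsManifold (𝓡 n) ∞ M] (X : VField n M) : Prop :=
  ContMDiff (𝓡 n) (𝓡 n).tangent ∞ (fun x => (⟨x, X x⟩ : TangentBundle (𝓡 n) M))

/-- The function `K(du, dv)`. -/
noncomputable def TwoTensor.onFun (K : TwoTensor n M) (u v : M → ℝ) : M → ℝ :=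
  fun x => K x (differential n u x) (differential n v x)

/-- A smooth symmetric contravariant two-tensor field: every `K x` is symmetric, and
`K(du, dv)` is smooth for all smooth functions `u`, `v` (on a Hausdorff manifold the
differentials of global smooth functions span the smooth one-forms near each point, so this says
that the components of `K` in every chart are smooth). -/
def IsSymTensor (K : TwoTensor n M) : Prop :=
  (∀ x p q, K x p q = K x q p) ∧
    ∀ u v : M → ℝ, SmoothFun n u → SmoothFun n v → SmoothFun n (K.onFun u v)

/-- A contravariant pseudo-Riemannian metric (of arbitrary signature): a smooth symmetric
contravariant two-tensor field which is nondegenerate at every point. -/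
def IsMetric (G : TwoTensor n M) : Prop :=
  IsSymTensor G ∧ ∀ x, (G x).Nondegenerate

/-- The Lie-Schouten bracket `[K, L]` of two symmetric contravariant two-tensor fields, as a
cubic form evaluated on `du`.  By definition `[K, L]` is the symmetric three-tensor whose cubic
form is the Poisson bracket `∑ᵢ (∂P_K/∂pᵢ ∂P_L/∂xⁱ - ∂P_K/∂xⁱ ∂P_L/∂pᵢ)` of
`P_K(x, p) = K_x(p, p)` and `P_L(x, p) = L_x(p, p)` on the cotangent bundle.  At `p = du` this is
the expression below: when the total derivatives of `L(du, du)` and `K(du, du)` are expanded, the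
terms with second derivatives of `u` cancel, because `K`, `L` and the Hessian are symmetric.
Every covector at `x` is `du` for a smooth `u`, so these values determine `[K, L]`. -/
noncomputable def schouten (K L : TwoTensor n M) (u : M → ℝ) (x : M) : ℝ :=
  2 * K x (differential n u x) (differential n (L.onFun u u) x)
    - 2 * L x (differential n u x) (differential n (K.onFun u u) x)

/-- `K` and `L` are in conformal involution with respect to `G`: `[K, L] = C ⊙ G` for some vector
field `C`, as an equality of cubic forms on the cotangent spaces.  (For smooth `K`, `L`, `G` with
`G` nondegenerate such a `C` is unique and smooth.  A constant factor on the right, such as the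
usual `2`, is absorbed by `C`.) -/
def InConformalInvolution (G K L : TwoTensor n M) : Prop :=
  ∃ C : VField n M, ∀ u : M → ℝ, SmoothFun n u → ∀ x,
    schouten K L u x = differential n u x (C x) * G.onFun u u x

/-- Conformal Killing (two-)tensors of the metric `G`: smooth symmetric two-tensor fields `K` with
`[K, G] = C ⊙ G` for some vector field `C`. -/
def IsConformalKillingTensor (G K : TwoTensor n M) : Prop :=
  IsSymTensor K ∧ InConformalInvolution G K G

/-- The derivative `X u` of a function `u` along a vector field `X`. -/
noncomputable def VField.deriv (X : VField n M) (u : M → ℝ) : M → ℝ :=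
  fun x => differential n u x (X x)

/-- The Lie derivative `L_X G` of a contravariant two-tensor field, evaluated on `(du, dv)`:
`(L_X G)(du, dv) = X (G(du, dv)) - G(d(X u), dv) - G(du, d(X v))`. -/
noncomputable def lieDeriv (X : VField n M) (G : TwoTensor n M) (u v : M → ℝ) (x : M) : ℝ :=
  X.deriv (G.onFun u v) x - G.onFun (X.deriv u) v x - G.onFun u (X.deriv v) x

/-- Conformal Killing vectors of the metric `G`: smooth vector fields `X` with `L_X G = F G` for
some function `F` (which is then automatically smooth). -/
def IsConformalKillingVector [IsManifold (𝓡 n) ∞ M] (G : TwoTensor n M) (X : VField n M) : Prop :=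
  IsSmoothVField X ∧ ∃ F : M → ℝ, ∀ u v : M → ℝ, SmoothFun n u → SmoothFun n v → ∀ x,
    lieDeriv X G u v x = F x * G.onFun u v x

/-- `E` is, at `x`, an eigenvector of `K` with respect to the metric `G`, with eigenvalue `l`:
`E ≠ 0` and `K^{ij} g_{jk} E^k = l E^i`, where `p_j = g_{jk} E^k` is the covector
obtained from `E` by lowering the index, i.e. `G(p, q) = q(E)` for all covectors `q`. -/
def IsEigenvectorAt (G K : TwoTensor n M) (x : M) (E : TangentSpace (𝓡 n) x) (l : ℝ) : Prop :=
  E ≠ 0 ∧ ∃ p : Cotangent n x, (∀ q : Cotangent n x, G x p q = q E) ∧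
    ∀ q : Cotangent n x, K x p q = l * q E

end

section

variable {m : ℕ} {M : Type*} [TopologicalSpace M]
  [ChartedSpace (EuclideanSpace ℝ (Fin (m + 1))) M]

/-- `(K_1, …, K_n = G)` is a basis of a conformal Killing space of the `n`-dimensional manifold
`(M, G)`, `n = m + 1`, with common eigenvectors `(E_i)` and (real) eigenvalues
`lam a i = λ_a^i` (of `K_a` on `E_i`): the `K_a` are `n` pointwise independent conformal Killing
tensors, pairwise in conformal involution, the last one is `G`, and the smooth vector fields `E_i`
are, at every point, a basis of common eigenvectors. -/
structure IsConformalKillingBasis [IsManifold (𝓡 (m + 1)) ∞ M]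
    (G : TwoTensor (m + 1) M) (K : Fin (m + 1) → TwoTensor (m + 1) M)
    (E : Fin (m + 1) → VField (m + 1) M) (lam : Fin (m + 1) → Fin (m + 1) → M → ℝ) : Prop where
  conformalKilling : ∀ a, IsConformalKillingTensor G (K a)
  involution : ∀ a b, InConformalInvolution G (K a) (K b)
  independent : ∀ x, LinearIndependent ℝ (fun a => K a x)
  last_eq : K (Fin.last m) = G
  smooth_eigenvectors : ∀ i, IsSmoothVField (E i)
  eigenvectors_independent : ∀ x, LinearIndependent ℝ (fun i => E i x)
  eigen : ∀ a i x, IsEigenvectorAt G (K a) x (E i x) (lam a i x)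

/-- The matrix `Λ = (λ_a^b)` of the eigenvalues at `x`; the row index is `a`, the column index
is `b`. -/
def eigenMatrix (lam : Fin (m + 1) → Fin (m + 1) → M → ℝ) (x : M) :
    Matrix (Fin (m + 1)) (Fin (m + 1)) ℝ :=
  Matrix.of fun a b => lam a b x

/-- `det Λ_j^i`, where `Λ_j^i` is `Λ` without its `j`-th row and its `i`-th column. -/
noncomputable def minorDet (lam : Fin (m + 1) → Fin (m + 1) → M → ℝ) (j i : Fin (m + 1))
    (x : M) : ℝ :=
  ((eigenMatrix lam x).submatrix j.succAbove i.succAbove).det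

/-- The fundamental function `f_i^{jh} = (-1)^{j+h} det Λ_j^i / det Λ_h^i`.  Its domain is the set
of points where `det Λ_h^i` does not vanish. -/
noncomputable def fundamentalFunction (lam : Fin (m + 1) → Fin (m + 1) → M → ℝ)
    (i j h : Fin (m + 1)) (x : M) : ℝ :=
  (-1) ^ ((j : ℕ) + (h : ℕ)) * (minorDet lam j i x / minorDet lam h i x)

/-- `f_i^{jh}` is undefined: its denominator vanishes identically. -/
def IsUndefined (lam : Fin (m + 1) → Fin (m + 1) → M → ℝ) (i h : Fin (m + 1)) : Prop :=
  ∀ x, minorDet lam h i x = 0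

/-- `f_i^{jh}` is constant on its domain. -/
def IsConstant (lam : Fin (m + 1) → Fin (m + 1) → M → ℝ) (i j h : Fin (m + 1)) : Prop :=
  ∃ c : ℝ, ∀ x, minorDet lam h i x ≠ 0 → fundamentalFunction lam i j h x = c

end

end ConformalSeparation

open ConformalSeparation

/-! The common eigenframe diagonalises every `K a`, with `E i ⊗ E i` as building blocks. Since `Λ`
is invertible, the relation inverts: `E i ⊗ E i = ∑ ρ_a K_a`, where `ρ_a` (`squareCoeff`) is the
signed minor divided by `ε_i det Λ` (`squareCoeff_spec`). Hence `f_i^{jh} = ρ_j / ρ_h`, and for `X =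
φ E_i` one has `X ⊗ X = ∑ ν_a K_a` with `ν_a = φ² ρ_a`.

Computing `[X ⊗ X, G]` in two ways (`two_mul_deriv_mul_lieDeriv`) relates `X ⊙ L_X G` to `∑ K_a ⊙
G(dν_a, ·)` modulo multiples of `G`, because each `[K_a, G]` is such a multiple. It follows that `X`
is conformal Killing exactly when `ν_a` is constant for every `a` other than the last, where `K_a =
G` (`exists_coeff_eq_const`, `isConformalKillingVector_of_coeff_eq_const`).

So some `φ` works iff the vector `(ρ_a)`, without its last entry, has constant direction. Constant
ratios give this globally because that vector never vanishes and the manifold is connected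
(`exists_pos_mul_const`); then `φ = |ρ_h|^{-1/2}` for a suitable `h`. -/

namespace ConformalSeparation

/-! ### Differentials and smooth functions on a manifold. -/

section Calculus

variable {n : ℕ} {M : Type*} [TopologicalSpace M] [ChartedSpace (EuclideanSpace ℝ (Fin n)) M]

theorem SmoothFun.mdifferentiableAt {u : M → ℝ} (hu : SmoothFun n u) (x : M) :
    MDifferentiableAt (𝓡 n) 𝓘(ℝ, ℝ) u x :=
  ContMDiff.mdifferentiable hu (by simp) x

theorem differential_add {u v : M → ℝ} {x : M} (hu : MDifferentiableAt (𝓡 n) 𝓘(ℝ, ℝ) u x)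
    (hv : MDifferentiableAt (𝓡 n) 𝓘(ℝ, ℝ) v x) :
    differential n (fun y => u y + v y) x = differential n u x + differential n v x :=
  mvfderiv_fun_add hu hv

theorem differential_mul {u v : M → ℝ} {x : M} (hu : MDifferentiableAt (𝓡 n) 𝓘(ℝ, ℝ) u x)
    (hv : MDifferentiableAt (𝓡 n) 𝓘(ℝ, ℝ) v x) :
    differential n (fun y => u y * v y) x = u x • differential n v x + v x • differential n u x :=
  mvfderiv_fun_mul hu hv

theorem differential_const (c : ℝ) (x : M) : differential n (fun _ : M => c) x = 0 :=
  mvfderiv_const c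

theorem differential_const_mul (c : ℝ) {u : M → ℝ} {x : M}
    (hu : MDifferentiableAt (𝓡 n) 𝓘(ℝ, ℝ) u x) :
    differential n (fun y => c * u y) x = c • differential n u x := by
  rw [differential_mul mdifferentiableAt_const hu, differential_const]
  simp

theorem differential_sum {ι : Type*} (s : Finset ι) {u : ι → M → ℝ} {x : M}
    (hu : ∀ a ∈ s, MDifferentiableAt (𝓡 n) 𝓘(ℝ, ℝ) (u a) x) :
    differential n (fun y => ∑ a ∈ s, u a y) x = ∑ a ∈ s, differential n (u a) x ∧
      MDifferentiableAt (𝓡 n) 𝓘(ℝ, ℝ) (fun y => ∑ a ∈ s, u a y) x := by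
  classical
  induction s using Finset.induction_on with
  | empty => simpa using ⟨differential_const 0 x, mdifferentiableAt_const⟩
  | insert a s ha ih =>
    obtain ⟨h1, h2⟩ := ih fun b hb => hu b (Finset.mem_insert_of_mem hb)
    have h3 := hu a (Finset.mem_insert_self a s)
    simp only [Finset.sum_insert ha]
    exact ⟨by rw [differential_add h3 h2, h1], MDifferentiableAt.add h3 h2⟩

theorem SmoothFun.add {u v : M → ℝ} (hu : SmoothFun n u) (hv : SmoothFun n v) :
    SmoothFun n (fun y => u y + v y) :=
  ContMDiff.add hu hv

theorem SmoothFun.const_mul (c : ℝ) {u : M → ℝ} (hu : SmoothFun n u) :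
    SmoothFun n (fun y => c * u y) :=
  ContMDiff.mul contMDiff_const hu

/-- Every covector is the differential of a smooth function. -/
theorem exists_smoothFun_differential_eq [T2Space M] [IsManifold (𝓡 n) ∞ M] (x : M)
    (p : Cotangent n x) : ∃ u : M → ℝ, SmoothFun n u ∧ differential n u x = p := by
  obtain ⟨f⟩ : Nonempty (SmoothBumpFunction (𝓡 n) x) := inferInstance
  -- The form `p` read in the chart at `x` and cut off by a bump function; the chart has identity
  -- derivative at its base point.
  let L : EuclideanSpace ℝ (Fin n) →L[ℝ] ℝ := p
  refine ⟨fun y => f y • L (extChartAt (𝓡 n) x y), ?_, ?_⟩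
  · refine f.contMDiff_smul ?_
    exact L.contMDiff.comp_contMDiffOn contMDiffOn_extChartAt
  · have h1 : (fun y => f y • L (extChartAt (𝓡 n) x y)) =ᶠ[nhds x]
        (L ∘ extChartAt (𝓡 n) x) := by
      filter_upwards [f.eventuallyEq_one] with y hy
      simp [hy]
    have h3 : MDifferentiableAt (𝓡 n) 𝓘(ℝ, EuclideanSpace ℝ (Fin n)) (extChartAt (𝓡 n) x) x :=
      mdifferentiableAt_extChartAt (mem_chart_source _ x)
    have h4 : MDifferentiableAt 𝓘(ℝ, EuclideanSpace ℝ (Fin n)) 𝓘(ℝ, ℝ) L (extChartAt (𝓡 n) x x) :=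
      L.mdifferentiableAt
    have h2 : mfderiv (𝓡 n) 𝓘(ℝ, ℝ) (fun y => f y • L (extChartAt (𝓡 n) x y)) x = p := by
      rw [h1.mfderiv_eq, mfderiv_comp x h4 h3, L.mfderiv_eq, mfderiv_extChartAt_self]
      rfl
    unfold differential mvfderiv
    rw [h2]
    rfl

theorem IsSmoothVField.smoothFun_deriv [IsManifold (𝓡 n) ∞ M] {X : VField n M}
    (hX : IsSmoothVField X) {u : M → ℝ} (hu : SmoothFun n u) : SmoothFun n (X.deriv u) := by
  have : IsManifold (𝓡 n) 1 M := IsManifold.of_le (n := ∞) (by simp)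
  have h1 : ContMDiff (𝓡 n).tangent 𝓘(ℝ, ℝ).tangent ∞ (tangentMap (𝓡 n) 𝓘(ℝ, ℝ) u) :=
    ContMDiff.contMDiff_tangentMap (n := ∞) hu (by simp)
  have h2 := h1.comp hX
  intro x
  have h3 := (Bundle.contMDiffAt_totalSpace.1 (h2 x)).2
  refine h3.congr_of_eventuallyEq (Filter.Eventually.of_forall fun y => ?_)
  simp [VField.deriv, differential, mvfderiv, tangentMap]
  rfl

/-- A function with vanishing differential on a connected manifold is constant. -/
theorem exists_eq_const_of_differential_eq_zero [IsManifold (𝓡 n) ∞ M] [ConnectedSpace M]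
    {f : M → ℝ} (hf : ∀ x, MDifferentiableAt (𝓡 n) 𝓘(ℝ, ℝ) f x)
    (h0 : ∀ x, differential n f x = 0) : ∃ c, ∀ x, f x = c := by
  have : IsManifold (𝓡 n) 1 M := IsManifold.of_le (n := ∞) (by simp)
  have hm : ∀ x, mfderiv (𝓡 n) 𝓘(ℝ, ℝ) f x = 0 := fun x => h0 x
  have hloc : IsLocallyConstant f := by
    rw [IsLocallyConstant.iff_eventually_eq]
    intro x
    set e := extChartAt (𝓡 n) x with he
    obtain ⟨r, hr, hball⟩ := Metric.isOpen_iff.1 (isOpen_extChartAt_target (I := 𝓡 n) x) (e x)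
      (mem_extChartAt_target x)
    have hd : ∀ z ∈ Metric.ball (e x) r, MDifferentiableAt 𝓘(ℝ, EuclideanSpace ℝ (Fin n)) 𝓘(ℝ, ℝ)
        (f ∘ e.symm) z ∧ mfderiv 𝓘(ℝ, EuclideanSpace ℝ (Fin n)) 𝓘(ℝ, ℝ) (f ∘ e.symm) z = 0 := by
      intro z hz
      have h1 : MDifferentiableAt 𝓘(ℝ, EuclideanSpace ℝ (Fin n)) (𝓡 n) e.symm z :=
        ((contMDiffOn_extChartAt_symm (n := 1) x).contMDiffAt
          ((isOpen_extChartAt_target x).mem_nhds (hball hz))).mdifferentiableAt (by simp)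
      refine ⟨(hf _).comp z h1, ?_⟩
      rw [mfderiv_comp z (hf _) h1, hm]
      simp
    obtain ⟨a, ha⟩ := Metric.isOpen_ball.exists_is_const_of_fderiv_eq_zero (𝕜 := ℝ)
      (convex_ball (e x) r).isPreconnected (f := f ∘ e.symm)
      (fun z hz => ((hd z hz).1.differentiableAt).differentiableWithinAt)
      (fun z hz => by
        have := (hd z hz).2
        rw [mfderiv_eq_fderiv] at this
        exact this)
    have hx : f x = a := by
      have := ha (e x) (Metric.mem_ball_self hr)
      rwa [Function.comp_apply, extChartAt_to_inv] at this
    filter_upwards [extChartAt_source_mem_nhds (I := 𝓡 n) x,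
      (continuousAt_extChartAt (I := 𝓡 n) x).preimage_mem_nhds (Metric.ball_mem_nhds _ hr)]
      with y hy hy'
    have := ha (e y) hy'
    rw [Function.comp_apply, e.left_inv hy] at this
    rw [this, hx]
  obtain ⟨x₀⟩ : Nonempty M := inferInstance
  exact ⟨f x₀, fun x => hloc.apply_eq_of_isPreconnected isPreconnected_univ trivial trivial⟩

theorem isSmoothVField_smul [IsManifold (𝓡 n) ∞ M] {X : VField n M} (hX : IsSmoothVField X)
    {f : M → ℝ} (hf : SmoothFun n f) : IsSmoothVField (fun x => f x • X x) :=
  ContMDiff.smul_section hf hX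

/-- The solution of a linear system with smooth coefficients is smooth where the determinant does
not vanish. -/
theorem contMDiffAt_of_linear_system {ι : Type*} [Fintype ι] [DecidableEq ι] {x₀ : M}
    {A : ι → ι → M → ℝ} {b ν : ι → M → ℝ}
    (hA : ∀ a k, ContMDiffAt (𝓡 n) 𝓘(ℝ, ℝ) ∞ (A a k) x₀)
    (hb : ∀ k, ContMDiffAt (𝓡 n) 𝓘(ℝ, ℝ) ∞ (b k) x₀)
    (h : ∀ k x, ∑ a, ν a x * A a k x = b k x)
    (hdet : (Matrix.of fun a k => A a k x₀).det ≠ 0) (a : ι) :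
    ContMDiffAt (𝓡 n) 𝓘(ℝ, ℝ) ∞ (ν a) x₀ := by
  have hprod : ∀ (s : Finset ι) (g : ι → M → ℝ),
      (∀ k, ContMDiffAt (𝓡 n) 𝓘(ℝ, ℝ) ∞ (g k) x₀) →
      ContMDiffAt (𝓡 n) 𝓘(ℝ, ℝ) ∞ (fun x => ∏ k ∈ s, g k x) x₀ :=
    fun s g hg => contMDiffAt_finsetProd fun k _ => hg k
  have hdetS : ∀ B : ι → ι → M → ℝ, (∀ a k, ContMDiffAt (𝓡 n) 𝓘(ℝ, ℝ) ∞ (B a k) x₀) →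
      ContMDiffAt (𝓡 n) 𝓘(ℝ, ℝ) ∞ (fun x => (Matrix.of fun a k => B a k x).det) x₀ := by
    intro B hB
    simp only [Matrix.det_apply, Matrix.of_apply]
    refine contMDiffAt_finsetSum fun σ _ => ?_
    have := hprod Finset.univ (fun k => B (σ k) k) fun k => hB _ _
    simp only [Units.smul_def, zsmul_eq_mul]
    exact contMDiffAt_const.mul this
  have hD := hdetS A hA
  -- Cramer's rule: `ν a` is the determinant with row `a` replaced by `b`, divided by `det A`.
  have hN := hdetS (fun a' k => if a' = a then b k else A a' k) (by
    intro a' k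
    split_ifs
    exacts [hb k, hA a' k])
  have hne : ∀ᶠ x in nhds x₀, (Matrix.of fun a k => A a k x).det ≠ 0 :=
    hD.continuousAt.eventually_ne hdet
  have hinv : ContMDiffAt (𝓡 n) 𝓘(ℝ, ℝ) ∞ (fun x => ((Matrix.of fun a k => A a k x).det)⁻¹) x₀ :=
    hD.inv₀ hdet
  refine (hN.mul hinv).congr_of_eventuallyEq ?_
  filter_upwards [hne] with x hx
  have hrow : (Matrix.of fun a' k => (if a' = a then b k else A a' k) x) =
      (Matrix.of fun a k => A a k x).updateRow a
        (∑ c, ν c x • (Matrix.of fun a k => A a k x) c) := by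
    ext a' k
    by_cases ha : a' = a
    · subst ha
      simp [Matrix.updateRow_self, Finset.sum_apply, h]
    · simp [ha]
  have key : (Matrix.of fun a' k => (if a' = a then b k else A a' k) x).det =
      ν a x * (Matrix.of fun a k => A a k x).det := by
    rw [hrow, Matrix.det_updateRow_sum]
    simp
  change _ = (Matrix.of fun a' k => (if a' = a then b k else A a' k) x).det * _
  rw [key, mul_inv_cancel_right₀ hx]

end Calculus

/-! ### Linear algebra at one point. -/

section Pointwise

variable {V : Type*} [AddCommGroup V] [Module ℝ V] [TopologicalSpace V] [IsTopologicalAddGroup V]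
  [ContinuousSMul ℝ V] [T2Space V] [FiniteDimensional ℝ V] {ι : Type*} [Fintype ι] [DecidableEq ι]

/-- The basis of covectors dual to a basis of vectors. -/
noncomputable def dualCovector (b : Module.Basis ι ℝ V) (k : ι) : V →L[ℝ] ℝ :=
  LinearMap.toContinuousLinearMap (b.coord k)

omit [Fintype ι] in
theorem dualCovector_apply (b : Module.Basis ι ℝ V) (k i : ι) :
    dualCovector b k (b i) = if i = k then 1 else 0 := by
  simp [dualCovector, Finsupp.single_apply]

theorem sum_smul_dualCovector (b : Module.Basis ι ℝ V) (p : V →L[ℝ] ℝ) :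
    ∑ i, p (b i) • dualCovector b i = p := by
  apply ContinuousLinearMap.coe_injective
  refine b.ext fun j => ?_
  simp [dualCovector_apply]

/-- Lowering the index of the eigenvectors gives a basis `p i` of covectors. Independence of the
forms makes the eigenvalue matrix invertible, so its columns are distinct; this forces the
eigenvectors to be orthogonal, even though a single form may have repeated eigenvalues. -/
theorem exists_diagonal_form {G : LinearMap.BilinForm ℝ (V →L[ℝ] ℝ)}
    {K : ι → LinearMap.BilinForm ℝ (V →L[ℝ] ℝ)} (hGs : ∀ p q, G p q = G q p)
    (hGn : G.Nondegenerate) (hKs : ∀ a p q, K a p q = K a q p) (hK : LinearIndependent ℝ K)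
    (b : Module.Basis ι ℝ V) {lam : ι → ι → ℝ}
    (heig : ∀ a i, ∃ p : V →L[ℝ] ℝ, (∀ q, G p q = q (b i)) ∧ ∀ q, K a p q = lam a i * q (b i)) :
    (Matrix.of lam).det ≠ 0 ∧ ∃ ε : ι → ℝ, (∀ i, ε i ≠ 0) ∧
      ∀ a p q, K a p q = ∑ i, lam a i * ε i * (p (b i) * q (b i)) := by
  choose P hP hPK using heig
  have hsep : ∀ p p' : V →L[ℝ] ℝ, (∀ q, G p q = G p' q) → p = p' := by
    intro p p' h
    rw [← sub_eq_zero]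
    exact hGn.1 _ fun q => by simp [h q]
  obtain ⟨p, hp, hpK⟩ : ∃ p : ι → (V →L[ℝ] ℝ), (∀ i q, G (p i) q = q (b i)) ∧
      ∀ a i q, K a (p i) q = lam a i * q (b i) := by
    refine ⟨fun i => P i i, fun i => hP i i, fun a i q => ?_⟩
    change K a (P i i) q = _
    rw [hsep (P i i) (P a i) fun q => by rw [hP, hP], hPK]
  have hli : LinearIndependent ℝ p := by
    rw [Fintype.linearIndependent_iff]
    intro c hc j
    have h := congrArg (fun r => G r (dualCovector b j)) hc
    simpa [map_sum, LinearMap.sum_apply, hp, dualCovector_apply] using h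
  have hfin : Fintype.card ι = Module.finrank ℝ (V →L[ℝ] ℝ) := by
    rw [← (LinearMap.toContinuousLinearMap (𝕜 := ℝ) (E := V) (F' := ℝ)).finrank_eq,
      Module.finrank_linearMap, Module.finrank_self, mul_one, Module.finrank_eq_card_basis b]
  have hne : Nonempty ι ∨ IsEmpty ι := (isEmpty_or_nonempty ι).symm
  have hdet : (Matrix.of lam).det ≠ 0 := by
    intro h0
    -- A left kernel vector would be a linear relation among the `K a`, as seen by evaluating on the
    -- basis `p i`.
    obtain ⟨v, hv, hv0⟩ := Matrix.exists_vecMul_eq_zero_iff.2 h0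
    have hz : ∑ a, v a • K a = 0 := by
      rcases hne with hne | hne
      · refine (basisOfLinearIndependentOfCardEqFinrank hli hfin).ext fun i => ?_
        refine LinearMap.ext fun q => ?_
        have h1 : ∑ a, v a * lam a i = 0 := congrFun hv0 i
        rw [coe_basisOfLinearIndependentOfCardEqFinrank, LinearMap.sum_apply,
          LinearMap.sum_apply]
        simp only [LinearMap.smul_apply, hpK, smul_eq_mul, ← mul_assoc, ← Finset.sum_mul, h1,
          zero_mul, LinearMap.zero_apply]
      · exact Finset.sum_of_isEmpty _
    have hv0 : ∀ a, v a = 0 := by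
      exact Fintype.linearIndependent_iffₛ.1 hK v 0 (by simpa using hz)
    exact hv (funext hv0)
  have hsymm : ∀ i j, p i (b j) = p j (b i) := fun i j => by
    rw [← hp j (p i), hGs, hp]
  have horth : ∀ i j, i ≠ j → p i (b j) = 0 := by
    intro i j hij
    by_contra hne
    -- If `p i (b j) ≠ 0`, symmetry of each `K a` gives `lam a i = lam a j`, so two columns
    -- coincide.
    refine hdet (Matrix.det_zero_of_column_eq hij fun a => ?_)
    have h1 : lam a i * p j (b i) = lam a j * p i (b j) := by
      rw [← hpK a i (p j), hKs, hpK]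
    rw [hsymm j i] at h1
    exact mul_right_cancel₀ hne h1
  have hη : ∀ i, p i (b i) ≠ 0 := by
    intro i h0
    have h1 : p i = 0 := by
      apply ContinuousLinearMap.coe_injective
      refine b.ext fun j => ?_
      by_cases hij : i = j
      · subst hij; simpa using h0
      · simpa using horth i j hij
    have := hp i (dualCovector b i)
    simp [h1, dualCovector_apply] at this
  have he : ∀ i, dualCovector b i = (p i (b i))⁻¹ • p i := by
    intro i
    apply ContinuousLinearMap.coe_injective
    refine b.ext fun j => ?_
    by_cases hij : j = i
    · subst hij; simp [dualCovector_apply, hη]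
    · simp [dualCovector_apply, hij, horth i j (Ne.symm hij)]
  refine ⟨hdet, fun i => (p i (b i))⁻¹, fun i => inv_ne_zero (hη i), fun a r q => ?_⟩
  conv_lhs => rw [← sum_smul_dualCovector b r]
  simp only [he, map_sum, map_smul, LinearMap.sum_apply, LinearMap.smul_apply, hpK, smul_eq_mul]
  exact Finset.sum_congr rfl fun i _ => by ring

/-- A cubic form `∑ i, L i p * ε i * (p (b i)) ^ 2` vanishes only if all `L i` do. -/
theorem eq_zero_of_sum_mul_sq_eq_zero (b : Module.Basis ι ℝ V) {ε : ι → ℝ} (hε : ∀ i, ε i ≠ 0)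
    {L : ι → (V →L[ℝ] ℝ) →ₗ[ℝ] ℝ} (h : ∀ p, ∑ i, L i p * ε i * (p (b i) * p (b i)) = 0) (i : ι) :
    L i = 0 := by
  have hdiag : ∀ k, L k (dualCovector b k) = 0 := by
    intro k
    have := h (dualCovector b k)
    simpa [dualCovector_apply, hε] using this
  have hoff : ∀ k, k ≠ i → L i (dualCovector b k) = 0 := by
    intro k hk
    -- Evaluate at `e^i + t e^k`; the choices `t = ±1` separate the odd part in `t` from the even
    -- part.
    have hs : ∀ t : ℝ, t * L i (dualCovector b k) * ε i
        + L k (dualCovector b i) * ε k * (t * t) = 0 := by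
      intro t
      have h1 := h (dualCovector b i + t • dualCovector b k)
      rw [Fintype.sum_eq_add i k hk.symm] at h1
      · simpa [dualCovector_apply, hk, hk.symm, hdiag] using h1
      · rintro j ⟨hji, hjk⟩
        simp [dualCovector_apply, hji, hjk]
    have h1 := hs 1
    have h2 := hs (-1)
    have h3 : L i (dualCovector b k) * ε i = 0 := by linarith
    exact (mul_eq_zero.1 h3).resolve_right (hε i)
  ext p
  rw [← sum_smul_dualCovector b p, map_sum, LinearMap.zero_apply]
  refine Finset.sum_eq_zero fun k _ => ?_
  rw [map_smul]
  by_cases hk : k = i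
  · rw [hk, hdiag, smul_zero]
  · rw [hoff k hk, smul_zero]

end Pointwise

/-! ### Diagonal form of the tensors and its inversion by cofactors. -/

section Basis

variable {m : ℕ} {M : Type*} [TopologicalSpace M]
  [ChartedSpace (EuclideanSpace ℝ (Fin (m + 1))) M] [IsManifold (𝓡 (m + 1)) ∞ M]
  {G : TwoTensor (m + 1) M} {K : Fin (m + 1) → TwoTensor (m + 1) M}
  {E : Fin (m + 1) → VField (m + 1) M} {lam : Fin (m + 1) → Fin (m + 1) → M → ℝ}

/-- The coefficient of `K_a` in `E_i ⊗ E_i`, where `ε` is `G (e^i, e^i)` for the coframe `e` dual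
to `E`. -/
noncomputable def squareCoeff (lam : Fin (m + 1) → Fin (m + 1) → M → ℝ) (ε : M → ℝ)
    (i a : Fin (m + 1)) (x : M) : ℝ :=
  ((ε x) * (eigenMatrix lam x).det)⁻¹ * ((-1) ^ ((a : ℕ) + (i : ℕ)) * minorDet lam a i x)

/-- The frame `E` at a point, as a basis. -/
noncomputable def IsConformalKillingBasis.frame (hK : IsConformalKillingBasis G K E lam) (x : M) :
    Module.Basis (Fin (m + 1)) ℝ (TangentSpace (𝓡 (m + 1)) x) :=
  basisOfLinearIndependentOfCardEqFinrank (hK.eigenvectors_independent x)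
    (by
      have : Module.finrank ℝ (EuclideanSpace ℝ (Fin (m + 1))) = m + 1 := by simp
      rw [Fintype.card_fin]
      exact this.symm)

theorem IsConformalKillingBasis.frame_apply (hK : IsConformalKillingBasis G K E lam) (x : M)
    (i : Fin (m + 1)) : hK.frame x i = E i x := by
  simp [frame]

instance tangentSpace_finiteDimensional {n : ℕ} {M : Type*} [TopologicalSpace M]
    [ChartedSpace (EuclideanSpace ℝ (Fin n)) M] (x : M) :
    FiniteDimensional ℝ (TangentSpace (𝓡 n) x) :=
  inferInstanceAs (FiniteDimensional ℝ (EuclideanSpace ℝ (Fin n)))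

instance tangentSpace_t2Space {n : ℕ} {M : Type*} [TopologicalSpace M]
    [ChartedSpace (EuclideanSpace ℝ (Fin n)) M] (x : M) : T2Space (TangentSpace (𝓡 n) x) :=
  inferInstanceAs (T2Space (EuclideanSpace ℝ (Fin n)))

theorem IsConformalKillingBasis.exists_diagonal (hK : IsConformalKillingBasis G K E lam)
    (hG : IsMetric G) :
    (∀ x, (eigenMatrix lam x).det ≠ 0) ∧ ∃ ε : Fin (m + 1) → M → ℝ, (∀ i x, ε i x ≠ 0) ∧
      (∀ a x p q, K a x p q = ∑ i, lam a i x * ε i x * (p (E i x) * q (E i x))) ∧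
      ∀ x p q, G x p q = ∑ i, ε i x * (p (E i x) * q (E i x)) := by
  have h := fun x => exists_diagonal_form (G := G x) (K := fun a => K a x)
    (lam := fun a i => lam a i x) (hG.1.1 x) (hG.2 x)
    (fun a => (hK.conformalKilling a).1.1 x) (hK.independent x) (hK.frame x)
    (fun a i => by simpa only [hK.frame_apply] using (hK.eigen a i x).2)
  choose hdet ε hε hform using h
  simp only [hK.frame_apply] at hform
  refine ⟨hdet, fun i x => ε x i, fun i x => hε x i, fun a x p q => hform x a p q,
    fun x p q => ?_⟩
  rw [← hK.last_eq, hform]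
  refine Finset.sum_congr rfl fun i _ => ?_
  have hlast : lam (Fin.last m) i x = 1 := by
    obtain ⟨-, p, hp, hp'⟩ := hK.eigen (Fin.last m) i x
    have h1 := hp (dualCovector (hK.frame x) i)
    have h2 := hp' (dualCovector (hK.frame x) i)
    have h3 : dualCovector (hK.frame x) i (E i x) = 1 := by
      rw [← hK.frame_apply, dualCovector_apply, if_pos rfl]
    rw [hK.last_eq, h1, h3] at h2
    linarith
  rw [hlast, one_mul]

omit [IsManifold (𝓡 (m + 1)) ∞ M] in
-- Inverts the diagonal form: the coefficients are row `i` of `Λ⁻¹`, written through the adjugate,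
-- divided by `ε i`.
theorem squareCoeff_spec {ε : Fin (m + 1) → M → ℝ} {x : M} (hdet : (eigenMatrix lam x).det ≠ 0)
    (hε : ∀ i, ε i x ≠ 0)
    (hform : ∀ a p q, K a x p q = ∑ i, lam a i x * ε i x * (p (E i x) * q (E i x)))
    (i : Fin (m + 1)) (p q : Cotangent (m + 1) x) :
    p (E i x) * q (E i x) = ∑ a, squareCoeff lam (ε i) i a x * K a x p q := by
  have hadj : ∀ k, ∑ a : Fin (m + 1), ((-1) ^ ((a : ℕ) + (i : ℕ)) * minorDet lam a i x) * lam a k x =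
      if i = k then (eigenMatrix lam x).det else 0 := by
    intro k
    have h := congrFun (congrFun (Matrix.adjugate_mul (eigenMatrix lam x)) i) k
    rw [Matrix.mul_apply] at h
    simp only [Matrix.adjugate_fin_succ_eq_det_submatrix, Matrix.smul_apply, Matrix.one_apply,
      smul_eq_mul, mul_ite, mul_one, mul_zero] at h
    exact h
  simp only [hform, Finset.mul_sum]
  rw [Finset.sum_comm]
  have h1 : ∀ k, ∑ a, squareCoeff lam (ε i) i a x *
      (lam a k x * ε k x * (p (E k x) * q (E k x))) =
      ((ε i x) * (eigenMatrix lam x).det)⁻¹ * (ε k x * (p (E k x) * q (E k x))) *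
        if i = k then (eigenMatrix lam x).det else 0 := by
    intro k
    rw [← hadj k, Finset.mul_sum]
    exact Finset.sum_congr rfl fun a _ => by rw [squareCoeff]; ring
  simp only [h1, mul_ite, mul_zero, Finset.sum_ite_eq, Finset.mem_univ, if_true]
  have := hε i
  field_simp

end Basis

/-! ### Lie derivative identities and the bracket of `X ⊗ X` with `G`. -/

section Identities

variable {n : ℕ} {M : Type*} [TopologicalSpace M] [ChartedSpace (EuclideanSpace ℝ (Fin n)) M]
  {G : TwoTensor n M}

theorem onFun_add_mul_left {u v : M → ℝ} (hu : SmoothFun n u) (hv : SmoothFun n v) (c : ℝ)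
    (w : M → ℝ) : G.onFun (fun y => u y + c * v y) w =
      fun y => G.onFun u w y + c * G.onFun v w y := by
  funext y
  simp only [TwoTensor.onFun]
  rw [differential_add (hu.mdifferentiableAt y) ((hv.const_mul c).mdifferentiableAt y),
    differential_const_mul c (hv.mdifferentiableAt y)]
  simp

theorem deriv_add_mul (X : VField n M) {u v : M → ℝ} (hu : SmoothFun n u) (hv : SmoothFun n v)
    (c : ℝ) : X.deriv (fun y => u y + c * v y) = fun y => X.deriv u y + c * X.deriv v y := by
  funext y
  simp only [VField.deriv]
  rw [differential_add (hu.mdifferentiableAt y) ((hv.const_mul c).mdifferentiableAt y),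
    differential_const_mul c (hv.mdifferentiableAt y)]
  simp

theorem IsSymTensor.onFun_comm (hG : IsSymTensor G) (u v : M → ℝ) : G.onFun u v = G.onFun v u :=
  funext fun x => hG.1 x _ _

theorem IsSymTensor.lieDeriv_comm (hG : IsSymTensor G) (X : VField n M) (u v : M → ℝ) (x : M) :
    lieDeriv X G u v x = lieDeriv X G v u x := by
  simp only [lieDeriv]
  rw [hG.onFun_comm u v, hG.onFun_comm (X.deriv u) v, hG.onFun_comm u (X.deriv v)]
  ring

theorem IsSymTensor.lieDeriv_add_mul_left [IsManifold (𝓡 n) ∞ M] (hG : IsSymTensor G)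
    {X : VField n M} (hX : IsSmoothVField X) {u v w : M → ℝ} (hu : SmoothFun n u)
    (hv : SmoothFun n v) (hw : SmoothFun n w) (c : ℝ) (x : M) :
    lieDeriv X G (fun y => u y + c * v y) w x =
      lieDeriv X G u w x + c * lieDeriv X G v w x := by
  simp only [lieDeriv]
  rw [onFun_add_mul_left hu hv, deriv_add_mul X (hG.2 u w hu hw) (hG.2 v w hv hw),
    deriv_add_mul X hu hv, onFun_add_mul_left (hX.smoothFun_deriv hu) (hX.smoothFun_deriv hv),
    onFun_add_mul_left hu hv]
  ring

/-- If `L_X G = F G` holds at `x` on the diagonal for the functions that are not critical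
along `X`, it holds at `x` for all functions. -/
theorem IsSymTensor.lieDeriv_eq_of_diagonal [T2Space M] [IsManifold (𝓡 n) ∞ M]
    (hG : IsSymTensor G) {X : VField n M} (hX : IsSmoothVField X) {x : M} {p : Cotangent n x}
    (hp : p (X x) ≠ 0) {F : ℝ}
    (h : ∀ u, SmoothFun n u → X.deriv u x ≠ 0 → lieDeriv X G u u x = F * G.onFun u u x)
    {u v : M → ℝ} (hu : SmoothFun n u) (hv : SmoothFun n v) :
    lieDeriv X G u v x = F * G.onFun u v x := by
  -- Expansion of the quadratic form `L_X G - F G`. It serves twice: with `c = ±1` to reach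
  -- functions critical along `X`, then to polarise.
  have hexp : ∀ u v : M → ℝ, SmoothFun n u → SmoothFun n v → ∀ c : ℝ,
      lieDeriv X G (fun y => u y + c * v y) (fun y => u y + c * v y) x
        - F * G.onFun (fun y => u y + c * v y) (fun y => u y + c * v y) x =
      (lieDeriv X G u u x - F * G.onFun u u x)
        + 2 * c * (lieDeriv X G u v x - F * G.onFun u v x)
        + c ^ 2 * (lieDeriv X G v v x - F * G.onFun v v x) := by
    intro u v hu hv c
    have hs : SmoothFun n (fun y => u y + c * v y) := hu.add (hv.const_mul c)
    rw [hG.lieDeriv_add_mul_left hX hu hv hs, hG.lieDeriv_comm X u, hG.lieDeriv_comm X v,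
      hG.lieDeriv_add_mul_left hX hu hv hu, hG.lieDeriv_add_mul_left hX hu hv hv,
      onFun_add_mul_left hu hv, hG.onFun_comm u, hG.onFun_comm v, onFun_add_mul_left hu hv,
      onFun_add_mul_left hu hv, hG.lieDeriv_comm X v u, hG.onFun_comm v u]
    ring
  have hdiag : ∀ u, SmoothFun n u → lieDeriv X G u u x - F * G.onFun u u x = 0 := by
    intro u hu
    by_cases hux : X.deriv u x = 0
    · obtain ⟨w, hw, hwp⟩ := exists_smoothFun_differential_eq x p
      have hwx : X.deriv w x ≠ 0 := by simpa only [VField.deriv, hwp] using hp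
      have hval : ∀ c : ℝ, c ≠ 0 → X.deriv (fun y => u y + c * w y) x ≠ 0 := by
        intro c hc
        rw [deriv_add_mul X hu hw]
        simpa [hux] using ⟨hc, hwx⟩
      have h1 := hexp u w hu hw 1
      have h2 := hexp u w hu hw (-1)
      rw [h _ (hu.add (hw.const_mul _)) (hval _ (by norm_num)), h w hw hwx] at h1 h2
      linarith
    · rw [h u hu hux, sub_self]
  have h1 := hexp u v hu hv 1
  rw [hdiag _ (hu.add (hv.const_mul 1)), hdiag u hu, hdiag v hv] at h1
  linarith

/-- The bracket of `X ⊗ X = ∑ a, ν a • K a` with `G`, computed in two ways. -/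
theorem two_mul_deriv_mul_lieDeriv [IsManifold (𝓡 n) ∞ M] {ι : Type*} [Fintype ι]
    {K : ι → TwoTensor n M} (hG : IsSymTensor G) (hK : ∀ a, IsSymTensor (K a)) {X : VField n M}
    (hX : IsSmoothVField X) {ν : ι → M → ℝ} (hν : ∀ a, SmoothFun n (ν a))
    (hXK : ∀ x, ∀ p q : Cotangent n x, p (X x) * q (X x) = ∑ a, ν a x * K a x p q)
    {u : M → ℝ} (hu : SmoothFun n u) (x : M) :
    2 * X.deriv u x * lieDeriv X G u u x
      + 2 * ∑ a, (K a).onFun u u x * G x (differential n u x) (differential n (ν a) x) =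
    ∑ a, ν a x * schouten (K a) G u x := by
  have hd := (hX.smoothFun_deriv hu).mdifferentiableAt x
  have hKd : ∀ a, MDifferentiableAt (𝓡 n) 𝓘(ℝ, ℝ) ((K a).onFun u u) x := fun a =>
    ((hK a).2 u u hu hu).mdifferentiableAt x
  -- Differentiating this identity and pairing with `du` by `G` produces the terms in `dν_a`.
  have hfun : (fun y => X.deriv u y * X.deriv u y) = fun y => ∑ a, ν a y * (K a).onFun u u y :=
    funext fun y => hXK y _ _
  have h1 := congrArg (fun w => G x (differential n u x) (differential n w x)) hfun
  rw [differential_mul hd hd, (differential_sum Finset.univ (u := fun a y => ν a y * (K a).onFun u u y) fun a _ =>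
    ((hν a).mdifferentiableAt x).mul (hKd a)).1] at h1
  simp only [differential_mul ((hν _).mdifferentiableAt x) (hKd _), map_add, map_sum, map_smul,
    smul_eq_mul, Finset.sum_add_distrib] at h1
  have h2 := hXK x (differential n u x) (differential n (G.onFun u u) x)
  have h3 : lieDeriv X G u u x = differential n (G.onFun u u) x (X x)
      - 2 * G x (differential n u x) (differential n (X.deriv u) x) := by
    simp only [lieDeriv]
    rw [hG.onFun_comm (X.deriv u) u]
    simp only [VField.deriv, TwoTensor.onFun]
    ring
  have h4 : ∑ a, ν a x * schouten (K a) G u x =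
      2 * ∑ a, ν a x * K a x (differential n u x) (differential n (G.onFun u u) x)
      - 2 * ∑ a, ν a x * G x (differential n u x) (differential n ((K a).onFun u u) x) := by
    rw [Finset.mul_sum, Finset.mul_sum, ← Finset.sum_sub_distrib]
    exact Finset.sum_congr rfl fun a _ => by simp only [schouten]; ring
  have h5 : X.deriv u x = differential n u x (X x) := rfl
  rw [h4, ← h2, h3]
  rw [h5] at h1 ⊢
  linarith

end Identities

/-! ### Smoothness of the coefficients of `X ⊗ X`. -/

section Main

variable {m : ℕ} {M : Type*} [TopologicalSpace M]
  [ChartedSpace (EuclideanSpace ℝ (Fin (m + 1))) M] [IsManifold (𝓡 (m + 1)) ∞ M]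
  {G : TwoTensor (m + 1) M} {K : Fin (m + 1) → TwoTensor (m + 1) M}
  {E : Fin (m + 1) → VField (m + 1) M} {lam : Fin (m + 1) → Fin (m + 1) → M → ℝ}

/-- The coefficients of `X ⊗ X` in the basis `K` are smooth if `X` is. -/
theorem IsConformalKillingBasis.smoothFun_of_sum_eq [T2Space M]
    (hK : IsConformalKillingBasis G K E lam) (hG : IsMetric G) {X : VField (m + 1) M}
    (hX : IsSmoothVField X) {ν : Fin (m + 1) → M → ℝ}
    (hXK : ∀ x, ∀ p q : Cotangent (m + 1) x, p (X x) * q (X x) = ∑ a, ν a x * K a x p q)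
    (a : Fin (m + 1)) : SmoothFun (m + 1) (ν a) := by
  intro x₀
  obtain ⟨hdet, ε, hε, hform, -⟩ := hK.exists_diagonal hG
  -- Test functions whose differentials at `x₀` are the dual coframe: the system for `ν` then has
  -- matrix `Λ · diag ε` at `x₀`, which is invertible.
  choose w hw hwd using fun k => exists_smoothFun_differential_eq x₀ (dualCovector (hK.frame x₀) k)
  refine contMDiffAt_of_linear_system (A := fun a k => (K a).onFun (w k) (w k))
    (b := fun k x => X.deriv (w k) x * X.deriv (w k) x)
    (fun a k => (hK.conformalKilling a).1.2 _ _ (hw k) (hw k) x₀)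
    (fun k => (hX.smoothFun_deriv (hw k) x₀).mul (hX.smoothFun_deriv (hw k) x₀))
    (fun k x => (hXK x _ _).symm) ?_ a
  have hmat : (Matrix.of fun a k => (K a).onFun (w k) (w k) x₀) =
      eigenMatrix lam x₀ * Matrix.diagonal fun k => ε k x₀ := by
    ext a k
    simp only [Matrix.of_apply, TwoTensor.onFun, hwd, hform, Matrix.mul_diagonal, eigenMatrix]
    rw [Fintype.sum_eq_single k]
    · rw [← hK.frame_apply, dualCovector_apply, if_pos rfl, mul_one, mul_one]
    · intro j hj
      rw [← hK.frame_apply, dualCovector_apply, if_neg hj, mul_zero, mul_zero]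
  rw [hmat, Matrix.det_mul, Matrix.det_diagonal]
  exact mul_ne_zero (hdet x₀) (Finset.prod_ne_zero_iff.2 fun k _ => hε k x₀)

end Main

/-! ### Conformal Killing vectors, constant coefficients and fundamental functions. -/

section FundamentalFunctions

variable {m : ℕ} {M : Type*} [TopologicalSpace M]
  [ChartedSpace (EuclideanSpace ℝ (Fin (m + 1))) M] [IsManifold (𝓡 (m + 1)) ∞ M]
  {G : TwoTensor (m + 1) M} {K : Fin (m + 1) → TwoTensor (m + 1) M}
  {E : Fin (m + 1) → VField (m + 1) M} {lam : Fin (m + 1) → Fin (m + 1) → M → ℝ}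

theorem squareCoeff_eq_zero_iff {M : Type*}
    {lam : Fin (m + 1) → Fin (m + 1) → M → ℝ} {ε : M → ℝ} {x : M} (hε : ε x ≠ 0)
    (hdet : (eigenMatrix lam x).det ≠ 0) (i a : Fin (m + 1)) :
    squareCoeff lam ε i a x = 0 ↔ minorDet lam a i x = 0 := by
  simp [squareCoeff, hε, hdet]

/-- The factor `(ε det Λ)⁻¹` cancels, and the cofactor signs `(-1)^{j+i}` and `(-1)^{h+i}` combine
to `(-1)^{j+h}`. -/
theorem fundamentalFunction_eq_div {M : Type*}
    {lam : Fin (m + 1) → Fin (m + 1) → M → ℝ} {ε : M → ℝ} {x : M} (hε : ε x ≠ 0)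
    (hdet : (eigenMatrix lam x).det ≠ 0) {i h : Fin (m + 1)} (hh : minorDet lam h i x ≠ 0)
    (j : Fin (m + 1)) :
    fundamentalFunction lam i j h x = squareCoeff lam ε i j x / squareCoeff lam ε i h x := by
  have hsq : ∀ k : ℕ, ((-1 : ℝ) ^ k) * (-1) ^ k = 1 := fun k => by
    rw [← mul_pow]; norm_num
  have hne : ∀ k : ℕ, ((-1 : ℝ) ^ k) ≠ 0 := fun k => pow_ne_zero _ (by norm_num)
  rw [fundamentalFunction, squareCoeff, squareCoeff, mul_div_mul_left _ _ (by positivity),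
    pow_add, pow_add, pow_add, eq_div_iff (by
      exact mul_ne_zero (mul_ne_zero (hne _) (hne _)) hh)]
  have := hsq h
  field_simp
  linear_combination minorDet lam j i x * this

/-- If `φ E_i` is a conformal Killing vector, then the coefficients of `φ E_i ⊗ φ E_i` on the
`K_a` other than `G` are constant. -/
theorem IsConformalKillingBasis.exists_coeff_eq_const [T2Space M] [ConnectedSpace M]
    (hK : IsConformalKillingBasis G K E lam) (hG : IsMetric G) {X : VField (m + 1) M}
    (hX : IsConformalKillingVector G X) {ν : Fin (m + 1) → M → ℝ}
    (hXK : ∀ x, ∀ p q : Cotangent (m + 1) x, p (X x) * q (X x) = ∑ a, ν a x * K a x p q)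
    {a : Fin (m + 1)} (ha : a ≠ Fin.last m) : ∃ c, ∀ x, ν a x = c := by
  obtain ⟨hXs, F, hF⟩ := hX
  have hν := hK.smoothFun_of_sum_eq hG hXs hXK
  choose C hC using fun a => (hK.conformalKilling a).2
  obtain ⟨hdet, ε, hε, hform, hformG⟩ := hK.exists_diagonal hG
  refine exists_eq_const_of_differential_eq_zero (fun x => (hν a).mdifferentiableAt x) fun x => ?_
  let ev : TangentSpace (𝓡 (m + 1)) x → Cotangent (m + 1) x →ₗ[ℝ] ℝ := fun v =>
    { toFun := fun p => p v, map_add' := fun p q => rfl, map_smul' := fun c p => rfl }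
  let D : Fin (m + 1) → Cotangent (m + 1) x →ₗ[ℝ] ℝ := fun a =>
    (G x).flip (differential (m + 1) (ν a) x)
  -- All multiples of `G` in the two-way computation, collected; what remains is `∑ K_a ⊙ D_a = C' ⊙
  -- G`.
  let C' : Cotangent (m + 1) x →ₗ[ℝ] ℝ := (2⁻¹ : ℝ) • ∑ a, ν a x • ev (C a x) - F x • ev (X x)
  have hcubic : ∀ p, ∑ a, K a x p p * D a p = C' p * G x p p := by
    intro p
    obtain ⟨u, hu, rfl⟩ := exists_smoothFun_differential_eq x p
    have key := two_mul_deriv_mul_lieDeriv hG.1 (fun a => (hK.conformalKilling a).1) hXs hν hXK hu x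
    rw [hF u u hu hu x] at key
    simp only [hC _ u hu x, ← mul_assoc, ← Finset.sum_mul] at key
    simp only [C', D, LinearMap.sub_apply, LinearMap.smul_apply, LinearMap.sum_apply, smul_eq_mul]
    change 2 * differential (m + 1) u x (X x) * F x * G x _ _ + 2 * ∑ a, K a x _ _ * _ =
      _ * G x _ _ at key
    change ∑ a, _ * G x _ (differential (m + 1) (ν a) x) = (2⁻¹ * ∑ a, ν a x * differential (m + 1) u x (C a x) -
      F x * differential (m + 1) u x (X x)) * _
    linarith
  have hL : ∀ i, ∑ a, lam a i x • D a - C' = 0 := by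
    refine eq_zero_of_sum_mul_sq_eq_zero (hK.frame x) (fun i => hε i x) fun p => ?_
    have h1 := hcubic p
    simp only [hform, hformG, Finset.sum_mul, Finset.mul_sum] at h1
    rw [Finset.sum_comm, ← sub_eq_zero, ← Finset.sum_sub_distrib] at h1
    rw [← h1]
    refine Finset.sum_congr rfl fun i _ => ?_
    simp only [LinearMap.sub_apply, LinearMap.sum_apply, LinearMap.smul_apply, smul_eq_mul,
      hK.frame_apply, sub_mul, Finset.sum_mul]
    congr 1
    · exact Finset.sum_congr rfl fun a _ => by ring
    · ring
  have hlast : ∀ i, lam (Fin.last m) i x = 1 := by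
    intro i
    have h1 := hform (Fin.last m) x (dualCovector (hK.frame x) i) (dualCovector (hK.frame x) i)
    rw [hK.last_eq, hformG, Fintype.sum_eq_single i, Fintype.sum_eq_single i] at h1
    · rw [← hK.frame_apply, dualCovector_apply, if_pos rfl] at h1
      have := hε i x
      field_simp at h1
      linarith
    all_goals
      intro j hj
      rw [← hK.frame_apply, dualCovector_apply, if_neg hj]
      ring
  refine (hG.2 x).2 _ fun p => ?_
  -- The last row of `Λ` consists of ones, so `C'` is absorbed into the last entry. Invertibility of
  -- `Λ` then kills every `D a` with `a` not last.
  have hker : Matrix.vecMul (fun a => D a p - if a = Fin.last m then C' p else 0)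
      (eigenMatrix lam x) = 0 := by
    funext i
    have h1 := LinearMap.congr_fun (hL i) p
    simp only [LinearMap.sub_apply, LinearMap.sum_apply, LinearMap.smul_apply, smul_eq_mul,
      LinearMap.zero_apply] at h1
    simp only [Matrix.vecMul, dotProduct, eigenMatrix, Matrix.of_apply, sub_mul, ite_mul, zero_mul,
      Finset.sum_sub_distrib, Finset.sum_ite_eq', Finset.mem_univ, if_true, hlast, mul_one,
      Pi.zero_apply]
    rw [← h1]
    congr 1
    exact Finset.sum_congr rfl fun a _ => mul_comm _ _
  have h0 := congrFun (Matrix.eq_zero_of_vecMul_eq_zero (hdet x) hker) a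
  simpa [ha, D] using h0

/-- If the coefficients of `X ⊗ X` on the `K_a` other than `G` are constant, where `X = φ E_i`,
then `X` is a conformal Killing vector. -/
theorem IsConformalKillingBasis.isConformalKillingVector_of_coeff_eq_const [T2Space M]
    (hK : IsConformalKillingBasis G K E lam) (hG : IsMetric G) {i : Fin (m + 1)} {f : M → ℝ}
    (hf : SmoothFun (m + 1) f) (hf0 : ∀ x, f x ≠ 0) {ν : Fin (m + 1) → M → ℝ}
    (hXK : ∀ x, ∀ p q : Cotangent (m + 1) x,
      p (f x • E i x) * q (f x • E i x) = ∑ a, ν a x * K a x p q)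
    (hc : ∀ a ≠ Fin.last m, ∃ c, ∀ x, ν a x = c) :
    IsConformalKillingVector G (fun x => f x • E i x) := by
  have hXs := isSmoothVField_smul (hK.smooth_eigenvectors i) hf
  refine ⟨hXs, ?_⟩
  set X : VField (m + 1) M := fun x => f x • E i x with hXdef
  have hν := hK.smoothFun_of_sum_eq hG hXs hXK
  choose C hC using fun a => (hK.conformalKilling a).2
  obtain ⟨hdet, ε, hε, hform, hformG⟩ := hK.exists_diagonal hG
  suffices h : ∀ x, ∃ F, ∀ u, SmoothFun (m + 1) u → X.deriv u x ≠ 0 →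
      lieDeriv X G u u x = F * G.onFun u u x by
    choose F hF using h
    refine ⟨F, fun u v hu hv x => hG.1.lieDeriv_eq_of_diagonal hXs
      (p := dualCovector (hK.frame x) i) ?_ (hF x) hu hv⟩
    rw [hXdef]
    simp only [map_smul, smul_eq_mul]
    rw [← hK.frame_apply, dualCovector_apply, if_pos rfl, mul_one]
    exact hf0 x
  intro x
  have hdν : ∀ a ≠ Fin.last m, differential (m + 1) (ν a) x = 0 := by
    intro a ha
    obtain ⟨c, hc⟩ := hc a ha
    rw [funext hc, differential_const]
  let ev : TangentSpace (𝓡 (m + 1)) x → Cotangent (m + 1) x →ₗ[ℝ] ℝ := fun v =>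
    { toFun := fun p => p v, map_add' := fun p q => rfl, map_smul' := fun c p => rfl }
  let C' : Cotangent (m + 1) x →ₗ[ℝ] ℝ := ∑ a, ν a x • ev (C a x) -
    (2 : ℝ) • (G x).flip (differential (m + 1) (ν (Fin.last m)) x)
  have hcubic : ∀ u, SmoothFun (m + 1) u → 2 * X.deriv u x * lieDeriv X G u u x =
      C' (differential (m + 1) u x) * G.onFun u u x := by
    intro u hu
    have key := two_mul_deriv_mul_lieDeriv hG.1 (fun a => (hK.conformalKilling a).1) hXs hν hXK hu x
    rw [Fintype.sum_eq_single (Fin.last m) (fun a ha => by rw [hdν a ha, map_zero, mul_zero]),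
      hK.last_eq] at key
    simp only [hC _ u hu x, ← mul_assoc, ← Finset.sum_mul] at key
    simp only [C', LinearMap.sub_apply, LinearMap.smul_apply, LinearMap.sum_apply, smul_eq_mul]
    change _ = (∑ a, ν a x * differential (m + 1) u x (C a x) -
      2 * G x (differential (m + 1) u x) (differential (m + 1) (ν (Fin.last m)) x)) * _
    linarith
  -- The covector `e^k` annihilates `X`, while `G(e^k, e^k) = ε k ≠ 0`. Hence `C'` is proportional
  -- to `E i`, and the factor `X u` can be divided out of `hcubic`.
  have hoff : ∀ k, k ≠ i → C' (dualCovector (hK.frame x) k) = 0 := by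
    intro k hk
    obtain ⟨u, hu, hud⟩ := exists_smoothFun_differential_eq x (dualCovector (hK.frame x) k)
    have h1 := hcubic u hu
    have h2 : X.deriv u x = 0 := by
      simp only [VField.deriv, hud, hXdef, map_smul]
      rw [← hK.frame_apply, dualCovector_apply, if_neg hk.symm, smul_zero]
    have h3 : G.onFun u u x = ε k x := by
      simp only [TwoTensor.onFun, hud, hformG]
      rw [Fintype.sum_eq_single k]
      · rw [← hK.frame_apply, dualCovector_apply, if_pos rfl, mul_one, mul_one]
      · intro j hj
        rw [← hK.frame_apply, dualCovector_apply, if_neg hj, mul_zero, mul_zero]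
    rw [h2, h3, hud, mul_zero, zero_mul] at h1
    exact (mul_eq_zero.1 h1.symm).resolve_right (hε k x)
  have hC' : ∀ p, C' p = p (E i x) * C' (dualCovector (hK.frame x) i) := by
    intro p
    conv_lhs => rw [← sum_smul_dualCovector (hK.frame x) p]
    rw [map_sum, Fintype.sum_eq_single i (fun k hk => by rw [map_smul, hoff k hk, smul_zero]),
      map_smul, hK.frame_apply, smul_eq_mul]
  refine ⟨C' (dualCovector (hK.frame x) i) / (2 * f x), fun u hu hux => ?_⟩
  have h1 := hcubic u hu
  have h2 : X.deriv u x = f x * differential (m + 1) u x (E i x) := by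
    simp only [VField.deriv, hXdef, map_smul, smul_eq_mul]
  rw [hC'] at h1
  rw [h2] at h1 hux
  have h3 := right_ne_zero_of_mul hux
  have h4 := hf0 x
  rw [div_mul_eq_mul_div, eq_div_iff (by positivity)]
  apply mul_left_cancel₀ h3
  linarith

/-- If the fundamental functions are constant, the vector of the coefficients of `E_i ⊗ E_i` on
the `K_a` other than `G` has a constant direction. -/
theorem IsConformalKillingBasis.exists_pos_mul_const [T2Space M] [ConnectedSpace M] (hm : 1 ≤ m)
    (hK : IsConformalKillingBasis G K E lam) (hG : IsMetric G) {ε : Fin (m + 1) → M → ℝ}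
    (hdet : ∀ x, (eigenMatrix lam x).det ≠ 0) (hε : ∀ i x, ε i x ≠ 0)
    (hform : ∀ a x p q, K a x p q = ∑ i, lam a i x * ε i x * (p (E i x) * q (E i x)))
    (hformG : ∀ x p q, G x p q = ∑ i, ε i x * (p (E i x) * q (E i x))) (i : Fin (m + 1))
    (hconst : ∀ h j : Fin (m + 1), h < j → j < Fin.last m →
      IsUndefined lam i h ∨ IsConstant lam i j h) :
    ∃ τ : M → ℝ, SmoothFun (m + 1) τ ∧ (∀ x, 0 < τ x) ∧ ∃ c : Fin (m + 1) → ℝ,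
      ∀ a ≠ Fin.last m, ∀ x, squareCoeff lam (ε i) i a x = c a * τ x := by
  have hsq := fun x => squareCoeff_spec (hdet x) (fun i => hε i x) (fun a => hform a x) i
  have hρ := hK.smoothFun_of_sum_eq hG (hK.smooth_eigenvectors i) hsq
  set ρ := squareCoeff lam (ε i) i with hρdef
  -- Otherwise `E i ⊗ E i` would be a multiple of `G`: a nonzero form of rank one against a
  -- nondegenerate one in dimension at least two.
  have hex : ∀ x, ∃ a, a ≠ Fin.last m ∧ ρ a x ≠ 0 := by
    intro x
    by_contra! hcon
    obtain ⟨k, hk⟩ : ∃ k : Fin (m + 1), k ≠ i := by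
      have : Nontrivial (Fin (m + 1)) := Fin.nontrivial_iff_two_le.2 (by omega)
      exact exists_ne i
    have hG1 : ∀ p : Cotangent (m + 1) x, p (E i x) * p (E i x) = ρ (Fin.last m) x * G x p p := by
      intro p
      rw [hsq x p p, Fintype.sum_eq_single (Fin.last m)
        (fun a ha => by rw [hcon a ha, zero_mul]), hK.last_eq]
    have h1 := hG1 (dualCovector (hK.frame x) k)
    rw [hformG, Fintype.sum_eq_single k, ← hK.frame_apply, ← hK.frame_apply, dualCovector_apply,
      dualCovector_apply, if_neg hk.symm, if_pos rfl, mul_one, mul_one, mul_zero] at h1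
    · have h2 := (mul_eq_zero.1 h1.symm).resolve_right (hε k x)
      have h3 := hG1 (dualCovector (hK.frame x) i)
      rw [h2, zero_mul, ← hK.frame_apply, dualCovector_apply, if_pos rfl, mul_one] at h3
      exact one_ne_zero h3
    · intro j hj
      rw [← hK.frame_apply, dualCovector_apply, if_neg hj, mul_zero, mul_zero]
  -- The smallest index is taken because the hypothesis only concerns `j > h`; for `j < h`
  -- minimality gives `ρ j = 0` identically.
  obtain ⟨h, ⟨hhl, x₁, hx₁⟩, hmin⟩ : ∃ h : Fin (m + 1), (h ≠ Fin.last m ∧ ∃ x, ρ h x ≠ 0) ∧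
      ∀ j < h, ¬ (j ≠ Fin.last m ∧ ∃ x, ρ j x ≠ 0) := by
    obtain ⟨x₀⟩ : Nonempty M := inferInstance
    obtain ⟨a, ha, hax⟩ := hex x₀
    obtain ⟨h, hh, hmin⟩ := WellFounded.has_min (wellFounded_lt (α := Fin (m + 1)))
      {h | h ≠ Fin.last m ∧ ∃ x, ρ h x ≠ 0} ⟨a, ha, x₀, hax⟩
    exact ⟨h, hh, fun j hj hj' => hmin j hj' hj⟩
  have hcoef : ∀ j : Fin (m + 1), ∃ c : ℝ, j ≠ Fin.last m →
      ∀ x, ρ h x ≠ 0 → ρ j x = c * ρ h x := by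
    intro j
    by_cases hjl : j = Fin.last m
    · exact ⟨0, fun hne => (hne hjl).elim⟩
    rcases lt_trichotomy j h with hj | hj | hj
    · refine ⟨0, fun _ x _ => ?_⟩
      by_contra hne
      rw [zero_mul] at hne
      exact hmin j hj ⟨hjl, x, hne⟩
    · exact ⟨1, fun _ x _ => by rw [hj, one_mul]⟩
    · rcases hconst h j hj (Fin.lt_last_iff_ne_last.2 hjl) with hu | ⟨c, hc⟩
      · exact (hx₁ ((squareCoeff_eq_zero_iff (hε i x₁) (hdet x₁) i h).2 (hu x₁))).elim
      · refine ⟨c, fun _ x hx => ?_⟩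
        have hminor : minorDet lam h i x ≠ 0 := fun h0 =>
          hx ((squareCoeff_eq_zero_iff (hε i x) (hdet x) i h).2 h0)
        rw [← hc x hminor, fundamentalFunction_eq_div (hε i x) (hdet x) hminor j,
          div_mul_cancel₀ _ hx]
  choose c hc using hcoef
  have hcont : ∀ a, Continuous (ρ a) := fun a => ContMDiff.continuous (hρ a)
  -- The relations `ρ a = c a * ρ h` persist on the closure, so a boundary zero of `ρ h` would be a
  -- zero of all `ρ a` with `a` not last, against `hex`.
  have hclopen : IsClopen {x | ρ h x ≠ 0} := by
    refine ⟨isClosed_of_closure_subset fun x hx hx0 => ?_, isOpen_ne_fun (hcont h) continuous_const⟩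
    obtain ⟨a, ha, hax⟩ := hex x
    have hcl : IsClosed {x | ρ a x = c a * ρ h x} :=
      isClosed_eq (hcont a) (continuous_const.mul (hcont h))
    have hxa : ρ a x = c a * ρ h x := closure_minimal (fun y hy => hc a ha y hy) hcl hx
    rw [hx0, mul_zero] at hxa
    exact hax hxa
  have hne : ∀ x, ρ h x ≠ 0 := fun x => by
    have : x ∈ {x | ρ h x ≠ 0} := by rw [hclopen.eq_univ ⟨x₁, hx₁⟩]; trivial
    exact this
  -- By connectedness `ρ h` has constant sign; if it is negative, both `ρ h` and `c` change sign.
  by_cases hpos : 0 < ρ h x₁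
  · refine ⟨ρ h, hρ h, fun x => ?_, c, fun a ha x => hc a ha x (hne x)⟩
    by_contra hx
    obtain ⟨y, hy⟩ := mem_range_of_exists_le_of_exists_ge (hcont h) ⟨x, not_lt.1 hx⟩ ⟨x₁, hpos.le⟩
    exact hne y hy
  · refine ⟨fun x => -1 * ρ h x, (hρ h).const_mul (-1), fun x => ?_, fun a => -c a,
      fun a ha x => by rw [hc a ha x (hne x)]; ring⟩
    by_contra hx
    obtain ⟨y, hy⟩ := mem_range_of_exists_le_of_exists_ge (hcont h) ⟨x₁, not_lt.1 hpos⟩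
      ⟨x, by linarith⟩
    exact hne y hy

end FundamentalFunctions

end ConformalSeparation

/-! ### The equivalence. -/

theorem theorem5p8 {m : ℕ} (hn : 2 < m + 1) {M : Type*} [TopologicalSpace M] [T2Space M]
    [SecondCountableTopology M] [ConnectedSpace M]
    [ChartedSpace (EuclideanSpace ℝ (Fin (m + 1))) M] [IsManifold (𝓡 (m + 1)) ∞ M]
    (G : TwoTensor (m + 1) M) (hG : IsMetric G)
    (K : Fin (m + 1) → TwoTensor (m + 1) M) (E : Fin (m + 1) → VField (m + 1) M)
    (lam : Fin (m + 1) → Fin (m + 1) → M → ℝ)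
    (hK : IsConformalKillingBasis G K E lam) (i : Fin (m + 1)) :
    (∃ f : M → ℝ, (∀ x, f x ≠ 0) ∧ IsConformalKillingVector G (fun x => f x • E i x)) ↔
      ∀ h j : Fin (m + 1), h < j → j < Fin.last m →
        IsUndefined lam i h ∨ IsConstant lam i j h := by
  obtain ⟨hdet, ε, hε, hform, hformG⟩ := hK.exists_diagonal hG
  have hsq : ∀ (f : M → ℝ) x (p q : Cotangent (m + 1) x),
      p (f x • E i x) * q (f x • E i x) =
        ∑ a, (f x ^ 2 * squareCoeff lam (ε i) i a x) * K a x p q := by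
    intro f x p q
    have h1 := squareCoeff_spec (hdet x) (fun i => hε i x) (fun a => hform a x) i p q
    simp only [map_smul, smul_eq_mul, mul_assoc, ← Finset.mul_sum]
    rw [← h1]
    ring
  constructor
  · rintro ⟨f, hf0, hf⟩ h j hhj hj
    have hjl := Fin.lt_last_iff_ne_last.1 hj
    have hhl := Fin.lt_last_iff_ne_last.1 (hhj.trans hj)
    obtain ⟨c, hc⟩ := hK.exists_coeff_eq_const hG hf
      (ν := fun a x => f x ^ 2 * squareCoeff lam (ε i) i a x) (hsq f) hjl
    obtain ⟨d, hd⟩ := hK.exists_coeff_eq_const hG hf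
      (ν := fun a x => f x ^ 2 * squareCoeff lam (ε i) i a x) (hsq f) hhl
    -- The coefficient `f² ρ_h` is the constant `d`: if zero, the minor vanishes identically; if
    -- not, the ratio is `c / d`.
    by_cases hd0 : d = 0
    · left
      intro x
      have h1 := hd x
      rw [hd0] at h1
      exact (squareCoeff_eq_zero_iff (hε i x) (hdet x) i h).1
        ((mul_eq_zero.1 h1).resolve_left (pow_ne_zero 2 (hf0 x)))
    · refine Or.inr ⟨c / d, fun x hx => ?_⟩
      rw [fundamentalFunction_eq_div (hε i x) (hdet x) hx j, ← hc x, ← hd x,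
        mul_div_mul_left _ _ (pow_ne_zero 2 (hf0 x))]
  · intro hconst
    obtain ⟨τ, hτ, hpos, c, hc⟩ := hK.exists_pos_mul_const (by omega) hG hdet hε hform hformG i hconst
    -- With `φ = τ^{-1/2}`, the coefficients `φ² ρ_a = φ² c_a τ` become the constants `c_a`.
    have hf : SmoothFun (m + 1) (fun x => (Real.sqrt (τ x))⁻¹) := by
      intro x
      have h1 : ContMDiffAt 𝓘(ℝ, ℝ) 𝓘(ℝ, ℝ) ∞ Real.sqrt (τ x) :=
        (Real.contDiffAt_sqrt (hpos x).ne').contMDiffAt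
      exact (h1.comp x (hτ x)).inv₀ (Real.sqrt_pos.2 (hpos x)).ne'
    have hf0 : ∀ x, (Real.sqrt (τ x))⁻¹ ≠ 0 := fun x => inv_ne_zero (Real.sqrt_pos.2 (hpos x)).ne'
    refine ⟨fun x => (Real.sqrt (τ x))⁻¹, hf0,
      hK.isConformalKillingVector_of_coeff_eq_const hG hf hf0 (hsq _) fun a ha => ⟨c a, fun x => ?_⟩⟩
    rw [hc a ha, inv_pow, Real.sq_sqrt (hpos x).le]
    have := (hpos x).ne'
    field_simp
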